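/- For $n\ge 0$ let $t_n\in\mathbb{F}_5$ be the sum of the base-5 digits of $n$, reduced modulo 5, and let $F=\sum_{n\ge 0}t_nX^n\in\mathbb{F}_5[[X]]$. There is a unique power series $G=\sum_{n\ge 0}d_nX^n\in\mathbb{F}_5[[X]]$ with $d_0=0$ and $F(G(X))=G(F(X))=X$; its coefficient sequence $(d_n)_{n\ge 0}$ is called the formal inverse of $(t_n)_{n\ge 0}$. The sequence $(d_n)_{n\ge 0}$ contains arbitrarily long sequences of consecutive $0$'s (for every $L$ there is $m$ with $d_m=d_{m+1}=\dots=d_{m+L-1}=0$), and the frequency of $0$'s in it is equal to $1$, i.e. $$\lim_{N\to\infty}\frac{|\{0\le k<N : d_k=0\}|}{N}=1.$$ -/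

import Mathlib

open Filter Topology

/-- The generalized Thue--Morse sequence: the sum of the base-`p` digits of `n`, taken modulo `p`. -/
def genThueMorse (p n : ℕ) : ZMod p := ((Nat.digits p n).sum : ZMod p)

/-- `b` is a formal inverse of `a`: the power series `F = ∑ aₙ Xⁿ` and `G = ∑ bₙ Xⁿ` have zero
constant terms (so that both compositions make sense) and `F(G(X)) = X = G(F(X))`.
Here `PowerSeries.subst G F` is `F(G(X))`. -/
def IsFormalInverse {R : Type*} [CommRing R] (a b : ℕ → R) : Prop :=
  a 0 = 0 ∧ b 0 = 0 ∧
    (PowerSeries.mk a).subst (PowerSeries.mk b) = (PowerSeries.X : PowerSeries R) ∧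
    (PowerSeries.mk b).subst (PowerSeries.mk a) = (PowerSeries.X : PowerSeries R)

/-- The sequence `a` contains arbitrarily long blocks of consecutive terms equal to `x`. -/
def HasArbitrarilyLongRuns {A : Type*} (a : ℕ → A) (x : A) : Prop :=
  ∀ L : ℕ, ∃ m : ℕ, ∀ i < L, a (m + i) = x

/-- The frequency of the letter `x` in `a` exists and equals `f`:
`#{k < N : a k = x} / N` tends to `f` as `N` tends to infinity. -/
def HasFrequency {A : Type*} (a : ℕ → A) (x : A) (f : ℝ) : Prop :=
  Tendsto (fun N : ℕ => ({k : ℕ | k < N ∧ a k = x}.ncard : ℝ) / (N : ℝ)) atTop (𝓝 f)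

/-!
The generating series `F` of the sum-of-digits sequence modulo `5` satisfies
`(1 - X)² F = (1 - X)⁶ F⁵ + X` (`genThueMorse_functional_equation`). Substituting the compositional
inverse `G` shows that `y = X (1 - G)` is the root with zero constant term of `P(y) = X`, where
`P(Y) = Y + Y² - Y⁶`; so, up to sign and a shift by one, the coefficients of `G` are those of `y`.

Put `D = 1 / P'(y)` (this is the derivative of `y`) and let `M` be the span of `yⁱ D` for `i ≤ 6`,
which contains `y`. Over `𝔽₅`, every power series is uniquely `∑_{k<5} Xᵏ g_k⁵`, where `g_k` is its
`k`-th section, with coefficients `a_{5n+k}`. Since `yⁱ D = yⁱ P'(y)⁴ D⁵`, the sections of `yⁱ D` are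
read off from the expansion of `yⁱ P'(y)⁴` in powers of `X = P(y)` with coefficients in `𝔽₅[y⁵]`.
These expansions (`exists_sections`) show that all sections preserve `M` and that the section along
the digit `4` annihilates every `yⁱ D` except `y⁴ D`, which it sends to `D`. Hence reading the digit
`4` twice in a row annihilates `M` (`digitSection_four_four`), and the `n`-th coefficient of `y`
vanishes as soon as some base-`25` digit of `n` equals `24` (`coeff_eq_zero_of_root`).

The integers with a given base-`25` digit equal to `24` contain arbitrarily long intervals, and those
with no such digit have density zero (`tendsto_countAvoiding_div`), since there are at most
`24ᵏ q` of them below `25ᵏ q`.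
-/

/-! ### Sections of power series over `𝔽₅` -/

namespace FiveInverse

open PowerSeries

/-- The `j`-th section operator on power series: `∑ aₙ Xⁿ ↦ ∑ a_{5n+j} Xⁿ`. -/
noncomputable def digitSection (j : Fin 5) : (ZMod 5)⟦X⟧ →ₗ[ZMod 5] (ZMod 5)⟦X⟧ where
  toFun f := PowerSeries.mk fun n => coeff (5 * n + j) f
  map_add' f g := by ext n; simp
  map_smul' c f := by ext n; simp

@[simp]
theorem coeff_digitSection (j : Fin 5) (f : (ZMod 5)⟦X⟧) (n : ℕ) :
    coeff n (digitSection j f) = coeff (5 * n + j) f := by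
  simp [digitSection]

theorem charP_five : CharP (ZMod 5)⟦X⟧ 5 :=
  have : Fact (Nat.Prime 5) := ⟨by norm_num⟩
  charP_of_injective_algebraMap (algebraMap (ZMod 5) (ZMod 5)⟦X⟧).injective 5

theorem five_eq_zero : (5 : (ZMod 5)⟦X⟧) = 0 := by
  have := charP_five
  exact_mod_cast CharP.cast_eq_zero (ZMod 5)⟦X⟧ 5

/-- Since the Frobenius map of `𝔽₅` is the identity, `g(X) ^ 5 = g(X ^ 5)`. -/
theorem coeff_pow_five (g : (ZMod 5)⟦X⟧) (n : ℕ) :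
    coeff n (g ^ 5) = if 5 ∣ n then coeff (n / 5) g else 0 := by
  have : Fact (Nat.Prime 5) := ⟨by norm_num⟩
  have h : g ^ 5 = expand 5 (by norm_num) g := by
    have := MvPowerSeries.map_frobenius_expand (σ := Unit) (R := ZMod 5) 5 (by norm_num) (f := g)
    rw [ZMod.frobenius_zmod 5, MvPowerSeries.map_id] at this
    exact this.symm
  rw [h, coeff_expand]

theorem coeff_sum_X_pow_mul_pow_five (g : Fin 5 → (ZMod 5)⟦X⟧) (j : Fin 5) (n : ℕ) :
    coeff (5 * n + j) (∑ k : Fin 5, X ^ (k : ℕ) * g k ^ 5) = coeff n (g j) := by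
  rw [map_sum, Finset.sum_eq_single j]
  · rw [coeff_X_pow_mul', if_pos (by omega), Nat.add_sub_cancel, coeff_pow_five,
      if_pos (by omega), Nat.mul_div_cancel_left n (by norm_num)]
  · intro k _ hk
    rw [coeff_X_pow_mul']
    split_ifs with h
    · rw [coeff_pow_five, if_neg]
      have := Fin.val_ne_of_ne hk
      omega
    · rfl
  · simp

theorem digitSection_sum (g : Fin 5 → (ZMod 5)⟦X⟧) (j : Fin 5) :
    digitSection j (∑ k : Fin 5, X ^ (k : ℕ) * g k ^ 5) = g j := by
  ext n
  rw [coeff_digitSection, coeff_sum_X_pow_mul_pow_five]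

theorem eq_sum_digitSection (f : (ZMod 5)⟦X⟧) :
    f = ∑ k : Fin 5, X ^ (k : ℕ) * digitSection k f ^ 5 := by
  ext n
  have h := coeff_sum_X_pow_mul_pow_five (fun k => digitSection k f) ⟨n % 5, by omega⟩ (n / 5)
  rw [coeff_digitSection] at h
  have hn : 5 * (n / 5) + n % 5 = n := by omega
  simp only [hn] at h
  exact h.symm

/-! ### The equation of the generalized Thue–Morse series -/

theorem genThueMorse_add (n : ℕ) (j : Fin 5) :
    genThueMorse 5 (5 * n + j) = genThueMorse 5 n + (j : ℕ) := by
  unfold genThueMorse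
  by_cases h : (j : ℕ) ≠ 0 ∨ n ≠ 0
  · rw [add_comm (5 * n), Nat.digits_add 5 (by norm_num) j n j.isLt h]
    simp [add_comm]
  · push Not at h
    simp [h.1, h.2]

theorem genThueMorse_functional_equation :
    (1 - X) ^ 2 * PowerSeries.mk (genThueMorse 5) =
      (1 - X) ^ 6 * PowerSeries.mk (genThueMorse 5) ^ 5 + (X : (ZMod 5)⟦X⟧) := by
  have := charP_five
  have : Fact (Nat.Prime 5) := ⟨by norm_num⟩
  have hE : (PowerSeries.mk 1 : (ZMod 5)⟦X⟧) * (1 - X) = 1 := mk_one_mul_one_sub_eq_one _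
  have hF := eq_sum_digitSection (PowerSeries.mk (genThueMorse 5))
  have hs : ∀ k : Fin 5, digitSection k (PowerSeries.mk (genThueMorse 5)) =
      PowerSeries.mk (genThueMorse 5) + ((k : ℕ) : (ZMod 5)⟦X⟧) * PowerSeries.mk 1 := by
    intro k
    ext n
    rw [coeff_digitSection, coeff_mk, genThueMorse_add, map_add, coeff_mk, ← nsmul_eq_mul,
      map_nsmul, coeff_mk]
    simp
  simp only [hs, add_pow_char, Fin.sum_univ_five] at hF
  generalize PowerSeries.mk (genThueMorse 5) = F at *
  generalize (PowerSeries.mk 1 : (ZMod 5)⟦X⟧) = E at *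
  have hE5 : E ^ 5 * (1 - X) ^ 5 = 1 := by rw [← mul_pow, hE, one_pow]
  have h5 := five_eq_zero
  simp only [Fin.val_zero, Fin.val_one, Fin.val_two, show ((3 : Fin 5) : ℕ) = 3 from rfl,
    show ((4 : Fin 5) : ℕ) = 4 from rfl] at hF
  push_cast at hF
  -- Modulo `5`, `∑_{k<5} Xᵏ = (1 - X)⁴` and `∑_{k<5} k⁵ Xᵏ = X (1 - X)³`; the multiples of `5`
  -- by which the two sides differ are the coefficients of `h5`.
  linear_combination (1 - X) ^ 2 * hF + X * hE5 + (1 - X) ^ 2 *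
    ((X - X ^ 2 + X ^ 3) * F ^ 5 + (7 * X ^ 2 + 48 * X ^ 3 + 205 * X ^ 4) * E ^ 5) * h5

/-! ### The root of `y + y² - y⁶ = X` -/

section Root

variable {y D : (ZMod 5)⟦X⟧}

/-- The space of the series `R(y) D`, where `R` is a polynomial of degree at most `6`. It is used
with `y` the root of `P(y) = y + y² - y⁶ = X` and `D` the inverse of `P'(y) = 1 + 2y - y⁵`. -/
def polySpan (y D : (ZMod 5)⟦X⟧) : Submodule (ZMod 5) (ZMod 5)⟦X⟧ :=
  Submodule.span (ZMod 5) {f | ∃ i < 7, f = y ^ i * D}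

theorem pow_mul_mem_polySpan {i : ℕ} (hi : i < 7) : y ^ i * D ∈ polySpan y D :=
  Submodule.subset_span ⟨i, hi, rfl⟩

theorem one_sub_pow_mul_mem_polySpan (a b : ℕ) (h : a + b < 7) :
    (1 - y) ^ a * y ^ b * D ∈ polySpan y D := by
  induction a generalizing b with
  | zero => simpa using pow_mul_mem_polySpan (y := y) (D := D) (i := b) (by omega)
  | succ a ih =>
    have := Submodule.sub_mem _ (ih b (by omega)) (ih (b + 1) (by omega))
    convert this using 1
    ring

theorem natCast_mul_mem_polySpan (m : ℕ) {f : (ZMod 5)⟦X⟧} (hf : f ∈ polySpan y D) :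
    (m : (ZMod 5)⟦X⟧) * f ∈ polySpan y D := by
  rw [← nsmul_eq_mul]
  exact Submodule.smul_of_tower_mem _ m hf

/-- An expansion of `yⁱ P'(y)⁴` in powers of `X = P(y)`, with coefficients `(c (1 - y)ᵉ yᶠ)⁵`,
yields the sections of `yⁱ D`. In the expansion `a` stands for `(1 - y)⁵ = 1 - y⁵`, in terms of
which `P(y) = a y + y²` and `P'(y) = a + 2 y`; the expansion is required for every `a`. -/
theorem exists_sections_of_expansion (hy : y + y ^ 2 - y ^ 6 = X)
    (hD : (1 + 2 * y - y ^ 5) * D = 1) (i : ℕ) (c e f : Fin 5 → ℕ) (hef : ∀ k, e k + f k < 7)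
    (h : ∀ a : (ZMod 5)⟦X⟧, y ^ i * (a + 2 * y) ^ 4 = ∑ k : Fin 5,
      (a * y + y ^ 2) ^ (k : ℕ) * ((c k : (ZMod 5)⟦X⟧) ^ 5 * (a ^ e k * (y ^ 5) ^ f k))) :
    ∃ g : Fin 5 → (ZMod 5)⟦X⟧, y ^ i * D = ∑ k : Fin 5, X ^ (k : ℕ) * g k ^ 5 ∧
      (∀ k, g k ∈ polySpan y D) ∧ g 4 = (c 4 : (ZMod 5)⟦X⟧) * ((1 - y) ^ e 4 * y ^ f 4 * D) := by
  have := charP_five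
  have : Fact (Nat.Prime 5) := ⟨by norm_num⟩
  have ha : (1 - y) ^ 5 = 1 - y ^ 5 := by rw [sub_pow_char, one_pow]
  have hX : (1 - y) ^ 5 * y + y ^ 2 = X := by rw [ha, ← hy]; ring
  have hD5 : D = ((1 - y) ^ 5 + 2 * y) ^ 4 * D ^ 5 := by
    calc D = D * ((1 + 2 * y - y ^ 5) * D) ^ 4 := by rw [hD]; ring
      _ = _ := by rw [ha]; ring
  refine ⟨fun k => c k * ((1 - y) ^ e k * y ^ f k * D), ?_, fun k => ?_, rfl⟩
  · calc y ^ i * D = y ^ i * ((1 - y) ^ 5 + 2 * y) ^ 4 * D ^ 5 := by rw [mul_assoc, ← hD5]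
      _ = _ := by
        rw [h, hX, Finset.sum_mul]
        refine Finset.sum_congr rfl fun k _ => ?_
        generalize 1 - y = A
        ring
  · exact natCast_mul_mem_polySpan _ (one_sub_pow_mul_mem_polySpan _ _ (hef k))

/-- The sections of `yⁱ D` lie in `polySpan y D`, and the last one is nonzero only for `i = 4`.
The `k`-th section is `R(y) D`, where the coefficient of `Yᵐ` in the polynomial `R` is that of
`Y⁵ᵐ⁺ᵏ` in `Yⁱ (1 + Y - Y⁵)⁴⁻ᵏ`, and `1 + Y - Y⁵ = P(Y) / Y`. Each of these `R` happens to be a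
constant multiple of some `(1 - Y)ᵉ Yᶠ`. -/
theorem exists_sections (hy : y + y ^ 2 - y ^ 6 = X) (hD : (1 + 2 * y - y ^ 5) * D = 1)
    {i : ℕ} (hi : i < 7) :
    ∃ g : Fin 5 → (ZMod 5)⟦X⟧, y ^ i * D = ∑ k : Fin 5, X ^ (k : ℕ) * g k ^ 5 ∧
      (∀ k, g k ∈ polySpan y D) ∧ g 4 = if i = 4 then D else 0 := by
  have h5 := five_eq_zero
  -- In each case the coefficient of `h5` is a fifth of the difference of the two sides of the
  -- expansion, computed over the integers.
  have key (c e f : Fin 5 → ℕ) := exists_sections_of_expansion hy hD i c e f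
  interval_cases i
  · have h := key ![1, 3, 1, 0, 0] ![4, 2, 0, 0, 0] ![0, 0, 0, 0, 0]
      (by decide) fun a => by
        simp [Fin.sum_univ_five]
        linear_combination
          (-47 * a ^ 3 * y - 44 * a ^ 2 * y ^ 2 + 6 * a * y ^ 3 + 3 * y ^ 4) * h5
    simpa using h
  · have h := key ![1, 1, 2, 0, 0] ![0, 3, 1, 0, 0] ![1, 0, 0, 0, 0]
      (by decide) fun a => by
        simp [Fin.sum_univ_five]
        linear_combination
          (-5 * a ^ 3 * y ^ 2 - 8 * a ^ 2 * y ^ 3 + 3 * y ^ 5) * h5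
    simpa using h
  · have h := key ![4, 0, 1, 1, 0] ![1, 0, 2, 0, 0] ![1, 0, 0, 0, 0]
      (by decide) fun a => by
        simp [Fin.sum_univ_five]
        linear_combination
          (a ^ 3 * y ^ 3 + 4 * a ^ 2 * y ^ 4 - 199 * a * y ^ 5 + 3 * y ^ 6) * h5
    simpa using h
  · have h := key ![1, 1, 0, 1, 0] ![2, 0, 0, 1, 0] ![1, 1, 0, 0, 0]
      (by decide) fun a => by
        simp [Fin.sum_univ_five]
        linear_combination
          (a ^ 3 * y ^ 4 + 4 * a ^ 2 * y ^ 5 + 6 * a * y ^ 6 + 3 * y ^ 7) * h5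
    simpa using h
  · have h := key ![4, 3, 0, 0, 1] ![3, 1, 0, 0, 0] ![1, 1, 0, 0, 0]
      (by decide) fun a => by
        simp [Fin.sum_univ_five]
        linear_combination
          (-204 * a ^ 3 * y ^ 5 - 45 * a ^ 2 * y ^ 6 - 43 * a * y ^ 7 + 3 * y ^ 8) * h5
    simpa using h
  · have h := key ![1, 3, 1, 0, 0] ![4, 2, 0, 0, 0] ![1, 1, 1, 0, 0]
      (by decide) fun a => by
        simp [Fin.sum_univ_five]
        linear_combination
          (y ^ 5 * (-47 * a ^ 3 * y - 44 * a ^ 2 * y ^ 2 + 6 * a * y ^ 3 + 3 * y ^ 4)) * h5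
    simpa using h
  · have h := key ![1, 1, 2, 0, 0] ![0, 3, 1, 0, 0] ![2, 1, 1, 0, 0]
      (by decide) fun a => by
        simp [Fin.sum_univ_five]
        linear_combination
          (y ^ 5 * (-5 * a ^ 3 * y ^ 2 - 8 * a ^ 2 * y ^ 3 + 3 * y ^ 5)) * h5
    simpa using h

theorem digitSection_mem_polySpan (hy : y + y ^ 2 - y ^ 6 = X) (hD : (1 + 2 * y - y ^ 5) * D = 1)
    (j : Fin 5) {f : (ZMod 5)⟦X⟧} (hf : f ∈ polySpan y D) : digitSection j f ∈ polySpan y D := by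
  suffices h : polySpan y D ≤ (polySpan y D).comap (digitSection j) from h hf
  refine Submodule.span_le.2 ?_
  rintro _ ⟨i, hi, rfl⟩
  obtain ⟨g, hg, hmem, -⟩ := exists_sections hy hD hi
  rw [SetLike.mem_coe, Submodule.mem_comap, hg, digitSection_sum]
  exact hmem j

/-- Two consecutive base-`5` digits `4` annihilate `polySpan y D`. -/
theorem digitSection_four_four (hy : y + y ^ 2 - y ^ 6 = X) (hD : (1 + 2 * y - y ^ 5) * D = 1)
    {f : (ZMod 5)⟦X⟧} (hf : f ∈ polySpan y D) : digitSection 4 (digitSection 4 f) = 0 := by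
  have h (i : ℕ) (hi : i < 7) : digitSection 4 (y ^ i * D) = if i = 4 then D else 0 := by
    obtain ⟨g, hg, -, h4⟩ := exists_sections hy hD hi
    rw [hg, digitSection_sum, h4]
  suffices h : polySpan y D ≤ LinearMap.ker (digitSection 4 ∘ₗ digitSection 4) by
    simpa using h hf
  refine Submodule.span_le.2 ?_
  rintro _ ⟨i, hi, rfl⟩
  have h0 := h 0 (by norm_num)
  simp only [pow_zero, one_mul] at h0
  rw [SetLike.mem_coe, LinearMap.mem_ker, LinearMap.comp_apply, h i hi]
  split_ifs
  · simpa using h0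
  · exact map_zero _

theorem coeff_eq_zero_of_mem_polySpan (hy : y + y ^ 2 - y ^ 6 = X)
    (hD : (1 + 2 * y - y ^ 5) * D = 1) (k : ℕ) {n : ℕ} (hn : n / 25 ^ k % 25 = 24)
    {f : (ZMod 5)⟦X⟧} (hf : f ∈ polySpan y D) : coeff n f = 0 := by
  induction k generalizing n f with
  | zero =>
    have h := congrArg (coeff (n / 25)) (digitSection_four_four hy hD hf)
    simp only [coeff_digitSection, map_zero] at h
    rw [← h]
    congr 2
    simp at hn ⊢
    omega
  | succ k ih =>
    have h := ih (n := n / 25) (by rw [Nat.div_div_eq_div_mul, ← pow_succ', hn])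
      (digitSection_mem_polySpan hy hD ⟨n / 5 % 5, by omega⟩
        (digitSection_mem_polySpan hy hD ⟨n % 5, by omega⟩ hf))
    simp only [coeff_digitSection] at h
    rw [← h]
    congr 2
    omega

end Root

theorem coeff_eq_zero_of_root {y : (ZMod 5)⟦X⟧} (h0 : constantCoeff y = 0)
    (hy : y + y ^ 2 - y ^ 6 = X) {n k : ℕ} (hn : n / 25 ^ k % 25 = 24) : coeff n y = 0 := by
  obtain ⟨D, hD⟩ := (isUnit_iff_constantCoeff (φ := 1 + 2 * y - y ^ 5)).2 (by simp [h0])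
    |>.exists_right_inv
  refine coeff_eq_zero_of_mem_polySpan hy hD k hn ?_
  have hm {i : ℕ} (hi : i < 7) := pow_mul_mem_polySpan (y := y) (D := D) hi
  have h := sub_mem (add_mem (hm (i := 1) (by norm_num))
    (add_mem (hm (i := 2) (by norm_num)) (hm (i := 2) (by norm_num)))) (hm (i := 6) (by norm_num))
  -- `y = y P'(y) D`, and `y P'(y) = y + 2 y² - y⁶`.
  convert h using 1
  linear_combination (-y) * hD

/-! ### Integers avoiding a digit -/

open Classical in
/-- The number of `n < N` no base-`b` digit of which (leading zeros included) equals `z`. -/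
noncomputable def countAvoiding (b z N : ℕ) : ℕ :=
  ((Finset.range N).filter fun n => ∀ k, n / b ^ k % b ≠ z).card

theorem countAvoiding_mono (b z : ℕ) : Monotone (countAvoiding b z) := fun _ _ h => by
  classical
  exact Finset.card_le_card
    (Finset.filter_subset_filter _ (Finset.range_subset_range.2 h))

theorem countAvoiding_le (b z N : ℕ) : countAvoiding b z N ≤ N := by
  classical
  exact (Finset.card_filter_le _ _).trans (Finset.card_range N).le

theorem countAvoiding_succ_le (b z N : ℕ) :
    countAvoiding b z (N + 1) ≤ countAvoiding b z N + 1 := by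
  classical
  rw [countAvoiding, countAvoiding, Finset.range_add_one, Finset.filter_insert]
  split_ifs
  · exact Finset.card_insert_le _ _
  · exact Nat.le_succ _

/-- Split off the last digit, for which `b - 1` values are allowed. -/
theorem countAvoiding_mul_le {b z : ℕ} (hz : z < b) (q : ℕ) :
    countAvoiding b z (b * q) ≤ (b - 1) * countAvoiding b z q := by
  classical
  have hb : 0 < b := by omega
  have hcard : ((Finset.range b).erase z).card = b - 1 := by
    rw [Finset.card_erase_of_mem (by simpa using hz), Finset.card_range]
  rw [countAvoiding, countAvoiding, ← hcard, ← Finset.card_product]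
  refine Finset.card_le_card_of_injOn (fun n => (n % b, n / b)) ?_ ?_
  · intro n hn
    simp only [Finset.coe_filter, Finset.mem_range, Set.mem_ofPred_eq] at hn
    simp only [Finset.coe_product, Set.mem_prod, Finset.mem_coe, Finset.mem_erase,
      Finset.mem_range, Finset.mem_filter]
    refine ⟨⟨by simpa using hn.2 0, Nat.mod_lt _ hb⟩, Nat.div_lt_of_lt_mul hn.1, fun k => ?_⟩
    rw [Nat.div_div_eq_div_mul, ← pow_succ']
    exact hn.2 (k + 1)
  · intro m _ n _ h
    simp only [Prod.mk.injEq] at h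
    rw [← Nat.div_add_mod m b, ← Nat.div_add_mod n b, h.1, h.2]

theorem countAvoiding_pow_mul_le {b z : ℕ} (hz : z < b) (k q : ℕ) :
    countAvoiding b z (b ^ k * q) ≤ (b - 1) ^ k * q := by
  induction k with
  | zero => simpa using countAvoiding_le b z q
  | succ k ih =>
    calc countAvoiding b z (b ^ (k + 1) * q) = countAvoiding b z (b * (b ^ k * q)) := by
          rw [pow_succ', mul_assoc]
      _ ≤ (b - 1) * ((b - 1) ^ k * q) :=
          (countAvoiding_mul_le hz _).trans (Nat.mul_le_mul_left _ ih)
      _ = (b - 1) ^ (k + 1) * q := by ring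

theorem tendsto_countAvoiding_div {b z : ℕ} (hz : z < b) :
    Tendsto (fun N : ℕ => (countAvoiding b z N : ℝ) / N) atTop (𝓝 0) := by
  have hb : (0 : ℝ) < b := by exact_mod_cast (by omega : 0 < b)
  have hb1 : ((b - 1 : ℕ) : ℝ) / b < 1 := by
    rw [div_lt_one hb]
    exact_mod_cast (by omega : b - 1 < b)
  rw [Metric.tendsto_atTop]
  intro ε hε
  obtain ⟨k, hk⟩ := exists_pow_lt_of_lt_one (half_pos hε) hb1
  obtain ⟨M, hM⟩ := exists_nat_gt (((b - 1 : ℕ) : ℝ) ^ k / (ε / 2))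
  refine ⟨M + 1, fun N hN => ?_⟩
  have hN0 : (0 : ℝ) < N := by exact_mod_cast (by omega : 0 < N)
  have hbound : countAvoiding b z N ≤ (b - 1) ^ k * (N / b ^ k + 1) :=
    (countAvoiding_mono b z (Nat.lt_mul_div_succ N (pow_pos (by omega) k)).le).trans
      (countAvoiding_pow_mul_le hz k _)
  have hreal : (countAvoiding b z N : ℝ) ≤ ((b - 1 : ℕ) : ℝ) ^ k * (N / (b : ℝ) ^ k + 1) := by
    refine (Nat.cast_le.2 hbound).trans ?_
    push_cast
    gcongr
    exact_mod_cast Nat.cast_div_le (α := ℝ) (m := N) (n := b ^ k)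
  rw [Real.dist_eq, sub_zero, abs_of_nonneg (by positivity), div_lt_iff₀ hN0]
  have h1 : ((b - 1 : ℕ) : ℝ) ^ k * (N / (b : ℝ) ^ k) < ε / 2 * N := by
    calc _ = (((b - 1 : ℕ) : ℝ) / b) ^ k * N := by rw [div_pow]; ring
      _ < _ := by gcongr
  have h2 : ((b - 1 : ℕ) : ℝ) ^ k < ε / 2 * N := by
    rw [div_lt_iff₀ (half_pos hε)] at hM
    have : (M : ℝ) ≤ N := by exact_mod_cast (by omega : M ≤ N)
    nlinarith
  linarith

end FiveInverse

open PowerSeries FiveInverse in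
theorem mainTheorem5 :
    ∃ d : ℕ → ZMod 5,
      (∀ e : ℕ → ZMod 5, IsFormalInverse (genThueMorse 5) e ↔ e = d) ∧
      HasArbitrarilyLongRuns d 0 ∧
      HasFrequency d 0 1 := by
  -- `F` and `G` are kept opaque, so that `simp` does not unfold them.
  obtain ⟨F, hF⟩ : ∃ F, F = PowerSeries.mk (genThueMorse 5) := ⟨_, rfl⟩
  have ht0 : genThueMorse 5 0 = 0 := by simp [genThueMorse]
  have hF0 : constantCoeff F = 0 := by
    rw [hF, ← coeff_zero_eq_constantCoeff_apply, coeff_mk, ht0]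
  have hF1 : IsUnit (coeff 1 F) := by simp [hF, genThueMorse]
  obtain ⟨G, hG⟩ : ∃ G, G = F.substInvOfIsUnit hF1 := ⟨_, rfl⟩
  have hG0 : constantCoeff G = 0 := by rw [hG]; exact constantCoeff_substInvOfIsUnit F hF1
  have hFG : F.subst G = X := by rw [hG]; exact subst_substInvOfIsUnit_right F hF0 hF1
  have hGF : G.subst F = X := by rw [hG]; exact subst_substInvOfIsUnit_left F hF0 hF1
  have hsF : HasSubst F := HasSubst.of_constantCoeff_zero' hF0
  have hsG : HasSubst G := HasSubst.of_constantCoeff_zero' hG0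
  have hG_eq : (1 - G) ^ 2 * X = (1 - G) ^ 6 * X ^ 5 + G := by
    have h := congrArg (substAlgHom (R := ZMod 5) hsG) genThueMorse_functional_equation
    rw [← hF] at h
    simp only [map_mul, map_pow, map_sub, map_one, map_add, substAlgHom_X] at h
    rwa [coe_substAlgHom, hFG] at h
  have hzero (n k : ℕ) (hn : (n + 1) / 25 ^ k % 25 = 24) : coeff n G = 0 := by
    -- Multiplied by `X`, the equation of `G` says that `X (1 - G)` is a root.
    have h := coeff_eq_zero_of_root (y := X * (1 - G)) (by simp)
      (by linear_combination X * hG_eq) hn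
    rw [coeff_succ_X_mul, map_sub, coeff_one] at h
    rcases Nat.eq_zero_or_pos n with rfl | hn0
    · simpa using hG0
    · simpa [hn0.ne'] using h
  refine ⟨fun n => coeff n G, fun e => ⟨fun he => ?_, ?_⟩, fun L => ?_, ?_⟩
  · obtain ⟨-, -, -, heF⟩ := he
    rw [← hF] at heF
    have h := congrArg (subst G) heF
    rw [subst_comp_subst_apply hsF hsG, hFG, X_subst, subst_X hsG] at h
    ext n
    rw [← h, coeff_mk]
  · rintro rfl
    have hmk : PowerSeries.mk (fun n => coeff n G) = G := by ext n; simp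
    refine ⟨ht0, by simpa using hG0, ?_, ?_⟩
    · rw [hmk, ← hF, hFG]
    · rw [hmk, ← hF, hGF]
  -- All of `24 * 25 ^ L, …, 24 * 25 ^ L + L - 1` have `24` as digit of index `L` in base `25`.
  · refine ⟨24 * 25 ^ L - 1, fun i hi => hzero _ L ?_⟩
    have hL : L < 25 ^ L := Nat.lt_pow_self (by norm_num)
    have : 24 * 25 ^ L - 1 + i + 1 = i + 25 ^ L * 24 := by omega
    rw [this, Nat.add_mul_div_left _ _ (by positivity), Nat.div_eq_of_lt (by omega)]
  · have hcount (N : ℕ) :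
        N ≤ {k : ℕ | k < N ∧ coeff k G = 0}.ncard + (countAvoiding 25 24 N + 1) := by
      classical
      have hset : {k : ℕ | k < N ∧ coeff k G = 0} =
          ((Finset.range N).filter fun k => coeff k G = 0 : Finset ℕ) := by ext; simp
      have hne : ((Finset.range N).filter fun k => ¬ coeff k G = 0).card ≤
          countAvoiding 25 24 (N + 1) := by
        refine Finset.card_le_card_of_injOn (· + 1) (fun n hn => ?_)
          (fun _ _ _ _ h => Nat.succ_injective h)
        simp only [Finset.coe_filter, Finset.mem_range, Set.mem_ofPred_eq] at hn ⊢
        exact ⟨by omega, fun k hk => hn.2 (hzero n k hk)⟩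
      have hsum := Finset.card_filter_add_card_filter_not (s := Finset.range N)
        (fun k => coeff k G = 0)
      rw [Finset.card_range] at hsum
      have := countAvoiding_succ_le 25 24 N
      rw [hset, Set.ncard_coe_finset]
      omega
    have hlim : Tendsto (fun N : ℕ => 1 - ((countAvoiding 25 24 N : ℝ) / N + 1 / N)) atTop
        (𝓝 1) := by
      simpa using tendsto_const_nhds.sub
        ((tendsto_countAvoiding_div (b := 25) (z := 24) (by norm_num)).add
          tendsto_one_div_atTop_nhds_zero_nat) (a := (1 : ℝ))
    refine tendsto_of_tendsto_of_tendsto_of_le_of_le' hlim tendsto_const_nhds ?_ ?_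
    · filter_upwards [eventually_gt_atTop 0] with N hN
      have hN' : (0 : ℝ) < N := by exact_mod_cast hN
      have h : (N : ℝ) ≤ {k : ℕ | k < N ∧ coeff k G = 0}.ncard + (countAvoiding 25 24 N + 1) := by
        exact_mod_cast hcount N
      rw [← add_div, sub_le_iff_le_add, ← add_div, one_le_div hN']
      exact h
    · refine Eventually.of_forall fun N => div_le_one_of_le₀ ?_ (Nat.cast_nonneg N)
      have h := Set.ncard_le_ncard (s := {k : ℕ | k < N ∧ coeff k G = 0})
        (t := (Finset.range N : Set ℕ)) (fun k hk => by simpa using hk.1) (Finset.finite_toSet _)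
      rw [Set.ncard_coe_finset, Finset.card_range] at h
      exact_mod_cast h
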